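/- Let $\mu$ be a Borel probability measure on $\mathbb{R}$ with $\int_{\mathbb{R}} x^2\,\mu(dx)<\infty$, and let $L^2(\mathbb{R},\mu)$ be the real Hilbert space of (classes of) square-integrable functions $\mathbb{R}\to\mathbb{R}$. Call $\Gamma\subset\mathbb{R}\times\mathbb{R}$ monotone if $(m_1-m_2)(x_1-x_2)\ge 0$ for all $(m_1,x_1),(m_2,x_2)\in\Gamma$. Let $\mathcal{C}$ be the set of all $X\in L^2(\mathbb{R},\mu)$ for which the support of the push-forward measure $(\mathrm{id},X)\#\mu$ is a monotone subset of $\mathbb{R}\times\mathbb{R}$; it is a closed convex cone, and $P_{\mathcal{C}}$ denotes the metric (nearest-point) projection of $L^2(\mathbb{R},\mu)$ onto $\mathcal{C}$. For $X\in L^2(\mathbb{R},\mu)$ let $H_X$ be the closure in $L^2(\mathbb{R},\mu)$ of the subspace $\{\varphi\circ X:\varphi\in C_c^\infty(\mathbb{R})\}$, and let $P_{H_X}$ be the orthogonal projection onto $H_X$. Proposition. Let $\bar X\in\mathcal{C}$ and $Y\in C([0,\infty),L^2(\mathbb{R},\mu))$, and define $$X_t := P_{\mathcal{C}}\Big(\bar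 X+\int_0^t Y_s\,ds\Big)\quad\text{for all } t\in[0,\infty).$$ Then for a.e. $t\in[0,\infty)$ the derivative $V_t$ of $t\mapsto X_t$ at $t$ exists (strongly, i.e. in the norm of $L^2(\mathbb{R},\mu)$) and satisfies $$V_t = P_{H_{X_t}}(Y_t).$$ -/

import Mathlib

open MeasureTheory Set Filter Topology

namespace StickyParticles

noncomputable section

/-! ### Metric projection onto a nonempty closed convex set -/

section Projection

variable {E : Type*} [NormedAddCommGroup E] [InnerProductSpace ℝ E] [CompleteSpace E]

/-- The nearest point of a nonempty closed convex subset `K` of a real Hilbert space to `y`: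
the element of `K` with `‖y - metricProj y‖ = inf {‖y - z‖ : z ∈ K}`. -/
def metricProj (K : Set E) (hne : K.Nonempty) (hcl : IsClosed K) (hconv : Convex ℝ K)
    (y : E) : E :=
  (exists_norm_eq_iInf_of_complete_convex hne hcl.isComplete hconv y).choose

theorem metricProj_spec (K : Set E) (hne : K.Nonempty) (hcl : IsClosed K)
    (hconv : Convex ℝ K) (y : E) :
    metricProj K hne hcl hconv y ∈ K ∧
      ‖y - metricProj K hne hcl hconv y‖ = ⨅ z : K, ‖y - z‖ :=
  (exists_norm_eq_iInf_of_complete_convex hne hcl.isComplete hconv y).choose_spec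

end Projection

/-! ### The cone of monotone maps in `L²(ℝ, μ)` -/

/-- A subset of the plane is monotone if `(m₁ - m₂) (x₁ - x₂) ≥ 0` for all its points
`(m₁, x₁)` and `(m₂, x₂)`. -/
def IsMonotoneSet (Γ : Set (ℝ × ℝ)) : Prop :=
  ∀ p ∈ Γ, ∀ q ∈ Γ, 0 ≤ (p.1 - q.1) * (p.2 - q.2)

/-- The transport plan `(id, X) # μ` induced by `X`. -/
def transportPlan (μ : Measure ℝ) (X : Lp ℝ 2 μ) : Measure (ℝ × ℝ) :=
  μ.map (fun m => (m, X m))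

/-- The set of all `X ∈ L²(ℝ, μ)` whose transport plan has monotone support. -/
def monotoneCone (μ : Measure ℝ) : Set (Lp ℝ 2 μ) :=
  {X | IsMonotoneSet (transportPlan μ X).support}

theorem measurable_graph {μ : Measure ℝ} (X : Lp ℝ 2 μ) :
    Measurable (fun m : ℝ => (m, X m)) :=
  measurable_id.prodMk (Lp.stronglyMeasurable X).measurable

theorem mem_monotoneCone_iff {μ : Measure ℝ} (X : Lp ℝ 2 μ) :
    X ∈ monotoneCone μ ↔
      ∃ s ∈ ae μ, ∀ m₁ ∈ s, ∀ m₂ ∈ s, 0 ≤ (m₁ - m₂) * (X m₁ - X m₂) := by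
  constructor
  · intro h
    have h1 : (transportPlan μ X).support ∈ ae (transportPlan μ X) :=
      Measure.support_mem_ae
    have h2 : (fun m : ℝ => (m, X m)) ⁻¹' (transportPlan μ X).support ∈ ae μ :=
      mem_ae_of_mem_ae_map (measurable_graph X).aemeasurable h1
    exact ⟨_, h2, fun m₁ h₁ m₂ h₂ => h _ h₁ _ h₂⟩
  · rintro ⟨s, hs, hmono⟩ p hp q hq
    by_contra! hneg
    have hopen : {z : (ℝ × ℝ) × (ℝ × ℝ) |
        (z.1.1 - z.2.1) * (z.1.2 - z.2.2) < 0} ∈ 𝓝 (p, q) :=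
      (isOpen_lt (by fun_prop) continuous_const).mem_nhds hneg
    rw [nhds_prod_eq, mem_prod_iff] at hopen
    obtain ⟨U, hU, V, hV, hUV⟩ := hopen
    have key : ∀ r ∈ (transportPlan μ X).support, ∀ W ∈ 𝓝 r, ∃ m ∈ s, (m, X m) ∈ W := by
      intro r hr W hW
      obtain ⟨O, hOW, hO, hrO⟩ := mem_nhds_iff.1 hW
      have hpos := (Measure.mem_support_iff_forall r).1 hr O (hO.mem_nhds hrO)
      rw [transportPlan, Measure.map_apply (measurable_graph X) hO.measurableSet] at hpos
      by_contra! hcon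
      refine hpos.ne' (measure_mono_null ?_ (mem_ae_iff.1 hs))
      intro m hm hms
      exact hcon m hms (hOW hm)
    obtain ⟨m₁, hm₁, hU₁⟩ := key p hp U hU
    obtain ⟨m₂, hm₂, hV₂⟩ := key q hq V hV
    have := hUV (Set.mk_mem_prod hU₁ hV₂)
    exact absurd (hmono m₁ hm₁ m₂ hm₂) (not_le.2 this)

theorem monotoneCone_nonempty (μ : Measure ℝ) : (monotoneCone μ).Nonempty := by
  refine ⟨0, (mem_monotoneCone_iff _).2 ⟨_, Lp.coeFn_zero ℝ 2 μ, fun m₁ h₁ m₂ h₂ => ?_⟩⟩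
  have h₁' : (0 : Lp ℝ 2 μ) m₁ = 0 := h₁
  have h₂' : (0 : Lp ℝ 2 μ) m₂ = 0 := h₂
  rw [h₁', h₂']
  simp

theorem convex_monotoneCone (μ : Measure ℝ) : Convex ℝ (monotoneCone μ) := by
  intro X hX Z hZ a b ha hb _
  obtain ⟨s, hs, hsX⟩ := (mem_monotoneCone_iff X).1 hX
  obtain ⟨t, ht, htZ⟩ := (mem_monotoneCone_iff Z).1 hZ
  have hae : ∀ᵐ m ∂μ, (a • X + b • Z : Lp ℝ 2 μ) m = a * X m + b * Z m := by
    filter_upwards [Lp.coeFn_add (a • X) (b • Z), Lp.coeFn_smul a X, Lp.coeFn_smul b Z]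
      with m h1 h2 h3
    rw [h1, Pi.add_apply, h2, h3]
    simp
  refine (mem_monotoneCone_iff _).2 ⟨_, inter_mem (inter_mem hs ht) hae, ?_⟩
  rintro m₁ ⟨⟨h1s, h1t⟩, h1⟩ m₂ ⟨⟨h2s, h2t⟩, h2⟩
  have h1' : (a • X + b • Z : Lp ℝ 2 μ) m₁ = a * X m₁ + b * Z m₁ := h1
  have h2' : (a • X + b • Z : Lp ℝ 2 μ) m₂ = a * X m₂ + b * Z m₂ := h2
  rw [h1', h2']
  have e1 := mul_nonneg ha (hsX m₁ h1s m₂ h2s)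
  have e2 := mul_nonneg hb (htZ m₁ h1t m₂ h2t)
  linarith

theorem isClosed_monotoneCone (μ : Measure ℝ) : IsClosed (monotoneCone μ) := by
  refine IsSeqClosed.isClosed fun F X hF hFX => ?_
  obtain ⟨ns, -, hns⟩ := (tendstoInMeasure_of_tendsto_Lp hFX).exists_seq_tendsto_ae
  choose s hs hmono using fun k => (mem_monotoneCone_iff (F k)).1 (hF k)
  have hall : ∀ᵐ m ∂μ, ∀ k, m ∈ s k := ae_all_iff.2 hs
  refine (mem_monotoneCone_iff X).2 ⟨_, inter_mem hall hns, ?_⟩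
  rintro m₁ ⟨h1, h1'⟩ m₂ ⟨h2, h2'⟩
  have h1'' : Tendsto (fun i => F (ns i) m₁) atTop (𝓝 (X m₁)) := h1'
  have h2'' : Tendsto (fun i => F (ns i) m₂) atTop (𝓝 (X m₂)) := h2'
  exact ge_of_tendsto' ((h1''.sub h2'').const_mul (m₁ - m₂))
    fun i => hmono (ns i) m₁ (h1 (ns i)) m₂ (h2 (ns i))

/-- The metric projection of `L²(ℝ, μ)` onto the cone of monotone maps. -/
def projCone (μ : Measure ℝ) (Z : Lp ℝ 2 μ) : Lp ℝ 2 μ :=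
  metricProj (monotoneCone μ) (monotoneCone_nonempty μ) (isClosed_monotoneCone μ)
    (convex_monotoneCone μ) Z

/-! ### The closed subspace generated by functions of `X` -/

open scoped ContDiff in
/-- The subspace `{φ ∘ X : φ ∈ C_c^∞(ℝ)}` of `L²(ℝ, μ)`; for finite `μ` each such `φ ∘ X` is
bounded, so its class does lie in `L²(ℝ, μ)`. -/
def testCompositions (μ : Measure ℝ) (X : Lp ℝ 2 μ) : Submodule ℝ (Lp ℝ 2 μ) where
  carrier := {W | ∃ φ : ℝ → ℝ, ContDiff ℝ ∞ φ ∧ HasCompactSupport φ ∧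
    ∀ᵐ m ∂μ, W m = φ (X m)}
  zero_mem' := by
    refine ⟨fun _ => 0, contDiff_const, HasCompactSupport.zero, ?_⟩
    filter_upwards [Lp.coeFn_zero ℝ 2 μ] with m hm
    rw [hm]; rfl
  add_mem' := by
    rintro V W ⟨φ, hφ, hφc, hV⟩ ⟨ψ, hψ, hψc, hW⟩
    refine ⟨fun x => φ x + ψ x, hφ.add hψ, hφc.add hψc, ?_⟩
    filter_upwards [Lp.coeFn_add V W, hV, hW] with m h1 h2 h3
    rw [h1, Pi.add_apply, h2, h3]
  smul_mem' := by
    rintro c W ⟨φ, hφ, hφc, hW⟩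
    refine ⟨fun x => c * φ x, contDiff_const.mul hφ, hφc.mul_left (f := fun _ => c), ?_⟩
    filter_upwards [Lp.coeFn_smul c W, hW] with m h1 h2
    rw [h1, Pi.smul_apply, h2, smul_eq_mul]

/-- The closed subspace `H_X`: the `L²(ℝ, μ)`-closure of `{φ ∘ X : φ ∈ C_c^∞(ℝ)}`. -/
abbrev closedSpan (μ : Measure ℝ) (X : Lp ℝ 2 μ) : Submodule ℝ (Lp ℝ 2 μ) :=
  (testCompositions μ X).topologicalClosure

end

end StickyParticles

/-!
The projection onto a closed convex set is `1`-Lipschitz, so `X = P_𝒞 ∘ Z` is locally Lipschitz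
whenever `Z` is; with values in a separable Hilbert space it is therefore strongly differentiable
almost everywhere. Let `V` be its derivative at such a time `t`. The two one-sided difference
quotients of a curve in `𝒞` force `V` and `-V` to be monotone along the level sets of `X_t`, so `V`
is constant on them and is a function of `X_t`, that is, `V ∈ H_{X_t}`. For `W = φ ∘ X_t` and small
`ε`, both `X_t ± ε W` lie in `𝒞`, so `Z_t - X_t ⟂ W`; then `s ↦ ⟪Z_s - X_s, X_t + ε W - X_s⟫` is
maximal at `t` with value `0`, and its derivative there is `ε ⟪Z'_t - V, W⟫`, because
`Z_t - X_t ⟂ V` for the same reason: `s ↦ ⟪Z_t - X_t, X_s - X_t⟫` is maximal at `t`. Hence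
`Z'_t - V ⟂ H_{X_t}`.
-/

namespace StickyParticles

section Rademacher

variable {E : Type*} [NormedAddCommGroup E] [InnerProductSpace ℝ E] {ι : Type*}

theorem countable_of_orthonormal [TopologicalSpace.SeparableSpace E] {b : ι → E}
    (hb : Orthonormal ℝ b) : Countable ι := by
  have one_lt_normSq (i j : ι) (hij : i ≠ j) : 1 < ‖b i - b j‖ ^ 2 := by
    rw [norm_sub_sq_real, hb.1 i, hb.1 j, hb.2 hij]
    norm_num
  have disjoint_balls : Pairwise (Function.onFun Disjoint fun i => Metric.ball (b i) (1 / 2)) := by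
    intro i j hij
    refine Metric.ball_disjoint_ball ?_
    rw [dist_eq_norm]
    nlinarith [one_lt_normSq i j hij, norm_nonneg (b i - b j)]
  exact disjoint_balls.countable_of_isOpen_disjoint (fun _ => Metric.isOpen_ball)
    fun i => ⟨b i, Metric.mem_ball_self (by norm_num)⟩

theorem exists_norm_le_and_inner_eq (b : HilbertBasis ι ℝ E) {c : ι → ℝ} {C : ℝ} (hC : 0 ≤ C)
    (hc : ∀ s : Finset ι, ∑ i ∈ s, c i ^ 2 ≤ C ^ 2) :
    ∃ v : E, ‖v‖ ≤ C ∧ ∀ i, inner ℝ (b i) v = c i := by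
  have hmem : Memℓp c 2 := memℓp_gen' (C := C ^ 2) fun s => by simpa using hc s
  refine ⟨b.repr.symm ⟨c, hmem⟩, ?_, fun i => ?_⟩
  · rw [LinearIsometryEquiv.norm_map]
    exact lp.norm_le_of_forall_sum_le (by norm_num) hC fun s => by simpa using hc s
  · rw [← b.repr_apply_apply, LinearIsometryEquiv.apply_symm_apply]

theorem lipschitzWith_inner_left {f : ℝ → E} {K : NNReal} (w : E) (hf : LipschitzWith K f) :
    LipschitzWith (‖w‖₊ * K) fun s => inner ℝ w (f s) := by
  have := (innerSL ℝ w).lipschitz.comp hf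
  rwa [show ‖innerSL ℝ w‖₊ = ‖w‖₊ from NNReal.eq (innerSL_apply_norm ℝ w)] at this

/- Tested against `w = ∑ c i • b i`, the curve has slope `∑ c i ^ 2 = ‖w‖ ^ 2`, which the
Lipschitz bound makes at most `K * ‖w‖`. -/
theorem sum_sq_deriv_inner_le {b : ι → E} (hb : Orthonormal ℝ b) {f : ℝ → E} {K : NNReal}
    (hf : LipschitzWith K f) {c : ι → ℝ} {t : ℝ}
    (hc : ∀ i, HasDerivAt (fun s => inner ℝ (b i) (f s)) (c i) t) (s : Finset ι) :
    ∑ i ∈ s, c i ^ 2 ≤ (K : ℝ) ^ 2 := by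
  set w := ∑ i ∈ s, c i • b i
  have normSq_w : ‖w‖ ^ 2 = ∑ i ∈ s, c i ^ 2 := by
    rw [← real_inner_self_eq_norm_sq, hb.inner_sum]
    simp [sq]
  have hderiv : HasDerivAt (fun u => inner ℝ w (f u)) (∑ i ∈ s, c i ^ 2) t := by
    have := HasDerivAt.fun_sum (u := s) fun i _ => (hc i).const_mul (c i)
    simpa only [w, sum_inner, real_inner_smul_left, sq] using this
  have hle : ‖w‖ ^ 2 ≤ ‖w‖ * K := by
    have := hderiv.le_of_lipschitz (lipschitzWith_inner_left w hf)
    rw [← normSq_w] at this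
    simpa using this
  rw [← normSq_w]
  nlinarith [norm_nonneg w, K.coe_nonneg, sq_nonneg (‖w‖ - K)]

variable {f : ℝ → E} {K : NNReal}

theorem exists_locallyIntegrable_weak_deriv [Countable ι] (b : HilbertBasis ι ℝ E)
    (hf : LipschitzWith K f) :
    ∃ v : ℝ → E, LocallyIntegrable v ∧
      ∀ᵐ t, ∀ i, HasDerivAt (fun s => inner ℝ (b i) (f s)) (inner ℝ (b i) (v t)) t := by
  let c (i : ι) : ℝ → ℝ := deriv fun s => inner ℝ (b i) (f s)
  have hc : ∀ᵐ t, ∀ i, HasDerivAt (fun s => inner ℝ (b i) (f s)) (c i t) t :=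
    ae_all_iff.2 fun i => (lipschitzWith_inner_left (b i) hf).ae_differentiableAt_real.mono
      fun _ ht => ht.hasDerivAt
  obtain ⟨v, hv⟩ := Filter.Eventually.choice <| hc.mono fun t ht =>
    exists_norm_le_and_inner_eq b K.coe_nonneg (sum_sq_deriv_inner_le b.orthonormal hf ht)
  have hv_meas : AEStronglyMeasurable v volume := by
    refine aestronglyMeasurable_of_tendsto_ae atTop
      (f := fun (s : Finset ι) t => ∑ i ∈ s, c i t • b i) (fun s => ?_) ?_
    · exact Finset.aestronglyMeasurable_fun_sum _ fun i _ =>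
        (stronglyMeasurable_deriv _).aestronglyMeasurable.smul_const _
    · filter_upwards [hv] with t ht
      have := b.hasSum_repr (v t)
      simp only [b.repr_apply_apply, ht.2] at this
      exact this
  refine ⟨v, (locallyIntegrable_const (K : ℝ)).mono hv_meas ?_, ?_⟩
  · filter_upwards [hv] with t ht using by simpa using ht.1
  · filter_upwards [hc, hv] with t hct hvt i
    rw [hvt.2 i]
    exact hct i

variable [CompleteSpace E]

theorem intervalIntegral_weak_deriv_eq_sub (b : HilbertBasis ι ℝ E) (hf : LipschitzWith K f)
    {v : ℝ → E} (hv : LocallyIntegrable v)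
    (hfv : ∀ᵐ t, ∀ i, HasDerivAt (fun s => inner ℝ (b i) (f s)) (inner ℝ (b i) (v t)) t)
    (x y : ℝ) : ∫ t in x..y, v t = f y - f x := by
  apply b.repr.injective
  ext i
  have hv_int : IntervalIntegrable v volume x y :=
    (hv.integrableOn_isCompact isCompact_uIcc).intervalIntegrable
  have habs : AbsolutelyContinuousOnInterval (fun t => inner ℝ (b i) (f t)) x y :=
    (lipschitzWith_inner_left (b i) hf).lipschitzOnWith.absolutelyContinuousOnInterval
  rw [b.repr_apply_apply, b.repr_apply_apply]
  calc inner ℝ (b i) (∫ t in x..y, v t)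
      = ∫ t in x..y, inner ℝ (b i) (v t) :=
        ((innerSL ℝ (b i)).intervalIntegral_comp_comm hv_int).symm
    _ = ∫ t in x..y, deriv (fun s => inner ℝ (b i) (f s)) t :=
        intervalIntegral.integral_congr_ae <| hfv.mono fun t ht _ => (ht i).deriv.symm
    _ = inner ℝ (b i) (f y - f x) := by rw [habs.integral_deriv_eq_sub, inner_sub_right]

variable [TopologicalSpace.SeparableSpace E]

theorem ae_differentiableAt_of_lipschitzWith (hf : LipschitzWith K f) :
    ∀ᵐ t, DifferentiableAt ℝ f t := by
  obtain ⟨w, b, -⟩ := exists_hilbertBasis ℝ E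
  have : Countable w := countable_of_orthonormal b.orthonormal
  obtain ⟨v, hv, hfv⟩ := exists_locallyIntegrable_weak_deriv b hf
  filter_upwards [LocallyIntegrable.ae_hasDerivAt_integral hv] with t ht
  have := (ht 0).add_const (f 0)
  simp only [intervalIntegral_weak_deriv_eq_sub b hf hv hfv, sub_add_cancel] at this
  exact this.differentiableAt

theorem ae_differentiableAt_of_lipschitzOnWith_Icc {x y : ℝ} (hxy : x ≤ y)
    (hf : LipschitzOnWith K f (Icc x y)) : ∀ᵐ t, t ∈ Ioo x y → DifferentiableAt ℝ f t := by
  let g := IccExtend hxy ((Icc x y).domRestrict f)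
  have hg : LipschitzWith (K * 1) g := hf.to_restrict.comp (LipschitzWith.projIcc hxy)
  filter_upwards [ae_differentiableAt_of_lipschitzWith hg] with t ht htxy
  refine ht.congr_of_eventuallyEq ?_
  filter_upwards [Icc_mem_nhds htxy.1 htxy.2] with s hs
  exact (IccExtend_of_mem hxy ((Icc x y).domRestrict f) hs).symm

theorem ae_differentiableAt_of_locallyLipschitzOn {U : Set ℝ} (hU : IsOpen U)
    (hf : LocallyLipschitzOn U f) : ∀ᵐ t ∂volume.restrict U, DifferentiableAt ℝ f t := by
  rw [ae_restrict_iff' hU.measurableSet]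
  refine measure_null_of_locally_null _ fun t ht => ?_
  have htU : t ∈ U := (Classical.not_imp.1 ht).1
  obtain ⟨K, s, hs, hK⟩ := hf htU
  rw [hU.nhdsWithin_eq htU] at hs
  obtain ⟨x, y, htxy, hnhds, hxys⟩ := exists_Icc_mem_subset_of_mem_nhds hs
  have hae := ae_differentiableAt_of_lipschitzOnWith_Icc (htxy.1.trans htxy.2) (hK.mono hxys)
  refine ⟨Ioo x y ∩ {r | ¬(r ∈ U → DifferentiableAt ℝ f r)}, ?_, measure_mono_null ?_ hae⟩
  · rw [← interior_Icc]
    exact inter_mem (mem_nhdsWithin_of_mem_nhds (interior_mem_nhds.2 hnhds)) self_mem_nhdsWithin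
  · exact fun r ⟨hr, hr'⟩ h => hr' fun _ => h hr

end Rademacher

section MetricProjection

variable {E : Type*} [NormedAddCommGroup E] [InnerProductSpace ℝ E] [CompleteSpace E]
  {K : Set E} (hne : K.Nonempty) (hcl : IsClosed K) (hconv : Convex ℝ K)

local notation "P" => metricProj K hne hcl hconv

theorem metricProj_mem (y : E) : P y ∈ K :=
  (metricProj_spec K hne hcl hconv y).1

theorem inner_sub_metricProj_le (y : E) {u : E} (hu : u ∈ K) :
    inner ℝ (y - P y) (u - P y) ≤ 0 :=
  (norm_eq_iInf_iff_real_inner_le_zero hconv (metricProj_mem hne hcl hconv y)).1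
    (metricProj_spec K hne hcl hconv y).2 u hu

theorem lipschitzWith_metricProj : LipschitzWith 1 P := by
  refine LipschitzWith.of_dist_le_mul fun y z => ?_
  rw [NNReal.coe_one, one_mul, dist_eq_norm, dist_eq_norm]
  have hy := inner_sub_metricProj_le hne hcl hconv y (metricProj_mem hne hcl hconv z)
  have hz := inner_sub_metricProj_le hne hcl hconv z (metricProj_mem hne hcl hconv y)
  have normSq_le : ‖P y - P z‖ ^ 2 ≤ ‖y - z‖ * ‖P y - P z‖ :=
    calc ‖P y - P z‖ ^ 2 = inner ℝ (y - z) (P y - P z) + inner ℝ (y - P y) (P z - P y)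
          + inner ℝ (z - P z) (P y - P z) := by
          rw [← real_inner_self_eq_norm_sq]
          simp only [inner_sub_left, inner_sub_right]
          ring
      _ ≤ inner ℝ (y - z) (P y - P z) := by linarith
      _ ≤ ‖y - z‖ * ‖P y - P z‖ := real_inner_le_norm _ _
  nlinarith [norm_nonneg (y - z), norm_nonneg (P y - P z)]

variable {hne hcl hconv} {Z : ℝ → E} {V Y W : E} {t : ℝ}

theorem inner_sub_metricProj_eq_zero {y : E} (hadd : P y + W ∈ K) (hsub : P y - W ∈ K) :
    inner ℝ (y - P y) W = 0 := by
  have hW := inner_sub_metricProj_le hne hcl hconv y hadd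
  have hnegW := inner_sub_metricProj_le hne hcl hconv y hsub
  rw [add_sub_cancel_left] at hW
  rw [sub_sub_cancel_left, inner_neg_right] at hnegW
  linarith

theorem inner_sub_metricProj_deriv_eq_zero (hX : HasDerivAt (fun s => P (Z s)) V t) :
    inner ℝ (Z t - P (Z t)) V = 0 := by
  have hmax : IsLocalMax (fun s => inner ℝ (Z t - P (Z t)) (P (Z s) - P (Z t))) t :=
    .of_forall fun s => by
      simpa using inner_sub_metricProj_le hne hcl hconv (Z t) (metricProj_mem hne hcl hconv (Z s))
  have hderiv := (hasDerivAt_const t (Z t - P (Z t))).inner ℝ (hX.sub_const (P (Z t)))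
  simpa using hmax.hasDerivAt_eq_zero hderiv

theorem inner_sub_deriv_metricProj_eq_zero (hZ : HasDerivAt Z Y t)
    (hX : HasDerivAt (fun s => P (Z s)) V t) (hadd : P (Z t) + W ∈ K) (hsub : P (Z t) - W ∈ K) :
    inner ℝ (Y - V) W = 0 := by
  have residual_W : inner ℝ (Z t - P (Z t)) W = 0 := inner_sub_metricProj_eq_zero hadd hsub
  have residual_V : inner ℝ (Z t - P (Z t)) V = 0 := inner_sub_metricProj_deriv_eq_zero hX
  have hmax : IsLocalMax (fun s => inner ℝ (Z s - P (Z s)) (P (Z t) + W - P (Z s))) t :=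
    .of_forall fun s => by
      simpa [residual_W] using inner_sub_metricProj_le hne hcl hconv (Z s) hadd
  have hderiv := (hZ.sub hX).inner ℝ (hX.const_sub (P (Z t) + W))
  simpa [residual_V] using hmax.hasDerivAt_eq_zero hderiv

end MetricProjection

section MonotoneCone

variable {μ : Measure ℝ} {X V W : Lp ℝ 2 μ}

theorem mem_monotoneCone_of_ae_eq_comp (hX : X ∈ monotoneCone μ) {g : ℝ → ℝ} (hg : Monotone g)
    (hW : W =ᵐ[μ] g ∘ X) : W ∈ monotoneCone μ := by
  obtain ⟨s, hs, hmono⟩ := (mem_monotoneCone_iff X).1 hX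
  refine (mem_monotoneCone_iff W).2 ⟨_, inter_mem hs hW, ?_⟩
  rintro m₁ ⟨hm₁, hW₁ : W m₁ = g (X m₁)⟩ m₂ ⟨hm₂, hW₂ : W m₂ = g (X m₂)⟩
  have hX₁₂ := hmono m₁ hm₁ m₂ hm₂
  rw [hW₁, hW₂]
  rcases lt_trichotomy (X m₁) (X m₂) with hlt | heq | hgt
  · have hm : m₁ - m₂ ≤ 0 := nonpos_of_mul_nonneg_left hX₁₂ (sub_neg.2 hlt)
    exact mul_nonneg_of_nonpos_of_nonpos hm (sub_nonpos.2 (hg hlt.le))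
  · rw [heq, sub_self, mul_zero]
  · have hm : 0 ≤ m₁ - m₂ := nonneg_of_mul_nonneg_left hX₁₂ (sub_pos.2 hgt)
    exact mul_nonneg hm (sub_nonneg.2 (hg hgt.le))

theorem monotone_id_add_mul_of_lipschitzWith {φ : ℝ → ℝ} {K : NNReal} (hφ : LipschitzWith K φ)
    {c : ℝ} (hc : |c| * K ≤ 1) : Monotone fun x => x + c * φ x := by
  intro x y hxy
  have hdiff : |c * (φ x - φ y)| ≤ y - x :=
    calc |c * (φ x - φ y)| ≤ |c| * (K * |x - y|) := by
          rw [abs_mul]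
          gcongr
          exact hφ.dist_le_mul x y
      _ = |c| * K * |x - y| := by ring
      _ ≤ 1 * |x - y| := by gcongr
      _ = y - x := by rw [one_mul, abs_sub_comm, abs_of_nonneg (sub_nonneg.2 hxy)]
  have := (abs_le.1 hdiff).2
  simp only
  linarith

theorem exists_add_smul_mem_and_sub_smul_mem_monotoneCone (hX : X ∈ monotoneCone μ)
    (hW : W ∈ testCompositions μ X) :
    ∃ ε : ℝ, 0 < ε ∧ X + ε • W ∈ monotoneCone μ ∧ X - ε • W ∈ monotoneCone μ := by
  obtain ⟨φ, hφ, hφ_supp, hWφ⟩ := hW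
  obtain ⟨K, hK⟩ := hφ.lipschitzWith_of_hasCompactSupport hφ_supp (by simp)
  have add_smul_mem (c : ℝ) (hc : |c| * K ≤ 1) : X + c • W ∈ monotoneCone μ := by
    refine mem_monotoneCone_of_ae_eq_comp hX (monotone_id_add_mul_of_lipschitzWith hK hc) ?_
    filter_upwards [Lp.coeFn_add X (c • W), Lp.coeFn_smul c W, hWφ] with m hadd hsmul hm
    rw [hadd, Pi.add_apply, hsmul, Pi.smul_apply, hm, smul_eq_mul, Function.comp_apply]
  have hε : |(K + 1 : ℝ)⁻¹| * K ≤ 1 := by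
    rw [abs_of_pos (by positivity), inv_mul_le_one₀ (by positivity)]
    linarith
  refine ⟨(K + 1 : ℝ)⁻¹, by positivity, add_smul_mem _ hε, ?_⟩
  rw [sub_eq_add_neg, ← neg_smul]
  exact add_smul_mem _ (by rwa [abs_neg])

/-- The elements of `L²(ℝ, μ)` that are monotone along the level sets of `X`, up to a `μ`-null
set. For `X ∈ monotoneCone μ` it contains the cone of directions tangent to `monotoneCone μ`
at `X`. -/
def levelMonotoneCone (μ : Measure ℝ) (X : Lp ℝ 2 μ) : Set (Lp ℝ 2 μ) :=
  {V | ∃ s ∈ ae μ, ∀ m₁ ∈ s, ∀ m₂ ∈ s, X m₁ = X m₂ → 0 ≤ (m₁ - m₂) * (V m₁ - V m₂)}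

theorem isClosed_levelMonotoneCone (μ : Measure ℝ) (X : Lp ℝ 2 μ) :
    IsClosed (levelMonotoneCone μ X) := by
  refine IsSeqClosed.isClosed fun F V hF hFV => ?_
  obtain ⟨k, -, hk⟩ := (tendstoInMeasure_of_tendsto_Lp hFV).exists_seq_tendsto_ae
  choose s hs hmono using hF
  have hall : ∀ᵐ m ∂μ, ∀ n, m ∈ s n := ae_all_iff.2 hs
  refine ⟨_, inter_mem hall hk, ?_⟩
  rintro m₁ ⟨hm₁, hlim₁⟩ m₂ ⟨hm₂, hlim₂⟩ hX
  exact ge_of_tendsto' ((Tendsto.sub hlim₁ hlim₂).const_mul (m₁ - m₂))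
    fun i => hmono (k i) m₁ (hm₁ (k i)) m₂ (hm₂ (k i)) hX

theorem smul_sub_mem_levelMonotoneCone (hW : W ∈ monotoneCone μ) {c : ℝ} (hc : 0 ≤ c) :
    c • (W - X) ∈ levelMonotoneCone μ X := by
  obtain ⟨s, hs, hmono⟩ := (mem_monotoneCone_iff W).1 hW
  have hae : ∀ᵐ m ∂μ, (c • (W - X) : Lp ℝ 2 μ) m = c * (W m - X m) := by
    filter_upwards [Lp.coeFn_smul c (W - X), Lp.coeFn_sub W X] with m hsmul hsub
    rw [hsmul, Pi.smul_apply, hsub, Pi.sub_apply, smul_eq_mul]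
  refine ⟨_, inter_mem hs hae, ?_⟩
  rintro m₁ ⟨hm₁, h₁ : _ = _⟩ m₂ ⟨hm₂, h₂ : _ = _⟩ hX
  calc 0 ≤ c * ((m₁ - m₂) * (W m₁ - W m₂)) := mul_nonneg hc (hmono m₁ hm₁ m₂ hm₂)
    _ = (m₁ - m₂) * ((c • (W - X) : Lp ℝ 2 μ) m₁ - (c • (W - X) : Lp ℝ 2 μ) m₂) := by
      rw [h₁, h₂, hX]
      ring

theorem exists_eqOn_levels_of_mem_levelMonotoneCone (hV : V ∈ levelMonotoneCone μ X)
    (hnegV : -V ∈ levelMonotoneCone μ X) :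
    ∃ s ∈ ae μ, ∀ m₁ ∈ s, ∀ m₂ ∈ s, X m₁ = X m₂ → V m₁ = V m₂ := by
  obtain ⟨s, hs, hmono⟩ := hV
  obtain ⟨r, hr, hanti⟩ := hnegV
  refine ⟨_, inter_mem (inter_mem hs hr) (Lp.coeFn_neg V), ?_⟩
  rintro m₁ ⟨⟨hs₁, hr₁⟩, hneg₁ : (-V : Lp ℝ 2 μ) m₁ = -V m₁⟩
    m₂ ⟨⟨hs₂, hr₂⟩, hneg₂ : (-V : Lp ℝ 2 μ) m₂ = -V m₂⟩ hX
  have h_nonneg := hmono m₁ hs₁ m₂ hs₂ hX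
  have h_nonpos := hanti m₁ hr₁ m₂ hr₂ hX
  rw [hneg₁, hneg₂] at h_nonpos
  have hzero : (m₁ - m₂) * (V m₁ - V m₂) = 0 := by linarith
  rcases mul_eq_zero.1 hzero with hm | hVm
  · rw [sub_eq_zero.1 hm]
  · exact sub_eq_zero.1 hVm

theorem mem_and_neg_mem_levelMonotoneCone_of_hasDerivAt {γ : ℝ → Lp ℝ 2 μ} {t : ℝ}
    (hγ : ∀ᶠ s in 𝓝 t, γ s ∈ monotoneCone μ) (hV : HasDerivAt γ V t) :
    V ∈ levelMonotoneCone μ (γ t) ∧ -V ∈ levelMonotoneCone μ (γ t) := by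
  have hγ_zero : ∀ᶠ h in 𝓝 (0 : ℝ), γ (t + h) ∈ monotoneCone μ :=
    (Continuous.tendsto' (by fun_prop) _ _ (add_zero t)).eventually hγ
  constructor
  · refine (isClosed_levelMonotoneCone μ (γ t)).mem_of_tendsto hV.tendsto_slope_zero_right ?_
    filter_upwards [self_mem_nhdsWithin, nhdsWithin_le_nhds hγ_zero] with h hh hmem
    exact smul_sub_mem_levelMonotoneCone hmem (inv_nonneg.2 (le_of_lt hh))
  · refine (isClosed_levelMonotoneCone μ (γ t)).mem_of_tendsto hV.tendsto_slope_zero_left.neg ?_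
    filter_upwards [self_mem_nhdsWithin, nhdsWithin_le_nhds hγ_zero] with h hh hmem
    rw [← neg_smul]
    exact smul_sub_mem_levelMonotoneCone hmem (neg_nonneg.2 (inv_nonpos.2 (le_of_lt hh)))

end MonotoneCone

section ClosedSpan

theorem exists_eq_measurable_comp_of_factorsThrough {α β γ : Type*} [MeasurableSpace α]
    [StandardBorelSpace α] [MeasurableSpace β] [MeasurableSpace.CountablySeparated β]
    [MeasurableSpace γ] [StandardBorelSpace γ] [Nonempty γ] {f : α → β} {g : α → γ}
    (hf : Measurable f) (hg : Measurable g) (hfg : Function.FactorsThrough g f) :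
    ∃ h : β → γ, Measurable h ∧ g = h ∘ f := by
  have hsurj : Function.Surjective (rangeFactorization f) := rangeFactorization_surjective
  have hf_range : Measurable (rangeFactorization f) := hf.subtype_mk
  have hg_factor : g = (g ∘ Function.surjInv hsurj) ∘ rangeFactorization f := by
    funext x
    exact hfg (congrArg Subtype.val (Function.surjInv_eq hsurj (rangeFactorization f x)).symm)
  have : MeasurableSpace.CountablySeparated (range f) :=
    MeasurableSpace.CountablySeparated.subtype_iff.2
      (HasCountableSeparatingOn.mono (fun _ => id) (subset_univ _))
  have hg_surjInv : Measurable (g ∘ Function.surjInv hsurj) := by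
    rwa [← hf_range.measurable_comp_iff_of_surjective hsurj, ← hg_factor]
  have hg_comap : Measurable[MeasurableSpace.comap f inferInstance] g := by
    rw [hg_factor]
    exact hg_surjInv.comp (Measurable.subtype_mk (comap_measurable f))
  exact hg_comap.exists_eq_measurable_comp

variable {μ : Measure ℝ} [IsFiniteMeasure μ] {X V : Lp ℝ 2 μ}

theorem mem_closedSpan_of_ae_eq_measurable_comp {h : ℝ → ℝ} (hh : Measurable h)
    (hV : V =ᵐ[μ] h ∘ X) : V ∈ closedSpan μ X := by
  have hX : MeasurePreserving X μ (μ.map X) :=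
    (Lp.stronglyMeasurable X).measurable.measurePreserving μ
  have hL : MemLp h 2 (μ.map X) := by
    rw [memLp_map_measure_iff hh.aestronglyMeasurable hX.aemeasurable]
    exact (memLp_congr_ae hV).1 (Lp.memLp V)
  let T := Lp.compMeasurePreservingₗᵢ (p := 2) ℝ (E := ℝ) X hX
  have coeFn_T {f : Lp ℝ 2 (μ.map X)} {k : ℝ → ℝ} (hfk : f =ᵐ[μ.map X] k) :
      T f =ᵐ[μ] k ∘ X :=
    (Lp.coeFn_compMeasurePreserving f hX).trans (hX.quasiMeasurePreserving.ae_eq_comp hfk)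
  have hT : T hL.toLp = V := Lp.ext ((coeFn_T hL.coeFn_toLp).trans hV.symm)
  rw [← hT]
  refine map_mem_closure T.continuous
    (Lp.dense_hasCompactSupport_contDiff (by simp) hL.toLp) ?_
  rintro f ⟨φ, hfφ, hφ_supp, hφ⟩
  exact ⟨φ, hφ, hφ_supp, coeFn_T hfφ⟩

theorem mem_closedSpan_of_eqOn_levels {s : Set ℝ} (hs : s ∈ ae μ)
    (hV : ∀ m₁ ∈ s, ∀ m₂ ∈ s, X m₁ = X m₂ → V m₁ = V m₂) : V ∈ closedSpan μ X := by
  obtain ⟨u, hu_ae, hu, hus⟩ := IsMeasurablyGenerated.exists_measurable_subset hs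
  have : StandardBorelSpace u := hu.standardBorel
  obtain ⟨h, hh, hVh⟩ := exists_eq_measurable_comp_of_factorsThrough
    (f := fun m : u => X m) (g := fun m : u => V m)
    ((Lp.stronglyMeasurable X).measurable.comp measurable_subtype_coe)
    ((Lp.stronglyMeasurable V).measurable.comp measurable_subtype_coe)
    fun m₁ m₂ => hV m₁ (hus m₁.2) m₂ (hus m₂.2)
  refine mem_closedSpan_of_ae_eq_measurable_comp hh ?_
  filter_upwards [hu_ae] with m hm using congrFun hVh ⟨m, hm⟩

theorem mem_closedSpan_of_hasDerivAt {γ : ℝ → Lp ℝ 2 μ} {t : ℝ}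
    (hγ : ∀ᶠ s in 𝓝 t, γ s ∈ monotoneCone μ) (hV : HasDerivAt γ V t) :
    V ∈ closedSpan μ (γ t) := by
  obtain ⟨hV_mem, hnegV_mem⟩ := mem_and_neg_mem_levelMonotoneCone_of_hasDerivAt hγ hV
  obtain ⟨s, hs, hs_levels⟩ := exists_eqOn_levels_of_mem_levelMonotoneCone hV_mem hnegV_mem
  exact mem_closedSpan_of_eqOn_levels hs hs_levels

end ClosedSpan

section ProjCone

theorem projCone_mem (μ : Measure ℝ) (y : Lp ℝ 2 μ) : projCone μ y ∈ monotoneCone μ :=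
  metricProj_mem _ _ _ y

variable {μ : Measure ℝ} [IsFiniteMeasure μ] {Z : ℝ → Lp ℝ 2 μ}

theorem starProjection_closedSpan_projCone {V Y : Lp ℝ 2 μ} {t : ℝ} (hZ : HasDerivAt Z Y t)
    (hX : HasDerivAt (fun s => projCone μ (Z s)) V t) :
    (closedSpan μ (projCone μ (Z t))).starProjection Y = V := by
  have hV_mem : V ∈ closedSpan μ (projCone μ (Z t)) :=
    mem_closedSpan_of_hasDerivAt (γ := fun s => projCone μ (Z s))
      (.of_forall fun s => projCone_mem μ (Z s)) hX
  refine Submodule.eq_starProjection_of_mem_orthogonal hV_mem ?_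
  rw [Submodule.orthogonal_closure, Submodule.mem_orthogonal']
  intro W hW
  obtain ⟨ε, hε, hadd, hsub⟩ :=
    exists_add_smul_mem_and_sub_smul_mem_monotoneCone (projCone_mem μ (Z t)) hW
  have hεW : inner ℝ (Y - V) (ε • W) = 0 := inner_sub_deriv_metricProj_eq_zero hZ hX hadd hsub
  rw [real_inner_smul_right] at hεW
  exact (mul_eq_zero.1 hεW).resolve_left hε.ne'

theorem ae_hasDerivAt_projCone_comp {Y : ℝ → Lp ℝ 2 μ} {U : Set ℝ} (hU : IsOpen U)
    (hZ_lip : LocallyLipschitzOn U Z) (hZ : ∀ t ∈ U, HasDerivAt Z (Y t) t) :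
    ∀ᵐ t ∂volume.restrict U, HasDerivAt (fun s => projCone μ (Z s))
      ((closedSpan μ (projCone μ (Z t))).starProjection (Y t)) t := by
  have : Fact ((2 : ENNReal) ≠ ⊤) := ⟨by simp⟩
  have hX_lip : LocallyLipschitzOn U fun s => projCone μ (Z s) := by
    intro t ht
    obtain ⟨K, s, hs, hK⟩ := hZ_lip ht
    exact ⟨1 * K, s, hs, (lipschitzWith_metricProj _ _ _).comp_lipschitzOnWith hK⟩
  filter_upwards [ae_differentiableAt_of_locallyLipschitzOn hU hX_lip,
    ae_restrict_mem hU.measurableSet] with t ht htU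
  rw [starProjection_closedSpan_projCone (hZ t htU) ht.hasDerivAt]
  exact ht.hasDerivAt

end ProjCone

section Primitive

variable {E : Type*} [NormedAddCommGroup E] [NormedSpace ℝ E]

theorem locallyLipschitzOn_of_hasStrictDerivAt {f f' : ℝ → E} {U : Set ℝ}
    (hf : ∀ t ∈ U, HasStrictDerivAt f (f' t) t) : LocallyLipschitzOn U f := by
  intro t ht
  obtain ⟨K, s, hs, hK⟩ := (hf t ht).hasStrictFDerivAt.exists_lipschitzOnWith
  exact ⟨K, s, mem_nhdsWithin_of_mem_nhds hs, hK⟩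

theorem hasStrictDerivAt_integral_of_continuousOn_Ici [CompleteSpace E] {Y : ℝ → E} {a t : ℝ}
    (hY : ContinuousOn Y (Ici a)) (ht : a < t) :
    HasStrictDerivAt (fun u => ∫ s in a..u, Y s) (Y t) t := by
  have hY_int : IntervalIntegrable Y volume a t :=
    (hY.mono (uIcc_of_le ht.le ▸ Icc_subset_Ici_self)).intervalIntegrable
  exact intervalIntegral.integral_hasStrictDerivAt_right hY_int
    ((hY.mono Ioi_subset_Ici_self).stronglyMeasurableAtFilter isOpen_Ioi t ht)
    (hY.continuousAt (Ici_mem_nhds ht))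

end Primitive

end StickyParticles

theorem proposition4p1_general (μ : Measure ℝ) [IsFiniteMeasure μ] (Xbar : Lp ℝ 2 μ)
    (Y : ℝ → Lp ℝ 2 μ) (hY : ContinuousOn Y (Set.Ici 0)) (X : ℝ → Lp ℝ 2 μ)
    (hX : ∀ t : ℝ, 0 ≤ t →
      X t = StickyParticles.projCone μ (Xbar + ∫ s in (0 : ℝ)..t, Y s)) :
    ∀ᵐ t ∂(volume.restrict (Set.Ici (0 : ℝ))),
      HasDerivAt X ((StickyParticles.closedSpan μ (X t)).starProjection (Y t)) t := by
  have hZ (t : ℝ) (ht : t ∈ Ioi 0) :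
      HasStrictDerivAt (fun u => Xbar + ∫ s in (0 : ℝ)..u, Y s) (Y t) t :=
    (StickyParticles.hasStrictDerivAt_integral_of_continuousOn_Ici hY ht).const_add Xbar
  rw [← restrict_Ioi_eq_restrict_Ici]
  filter_upwards [ae_restrict_mem measurableSet_Ioi,
    StickyParticles.ae_hasDerivAt_projCone_comp isOpen_Ioi
      (StickyParticles.locallyLipschitzOn_of_hasStrictDerivAt hZ)
      fun t ht => (hZ t ht).hasDerivAt] with t ht hderiv
  rw [hX t (le_of_lt ht)]
  refine hderiv.congr_of_eventuallyEq ?_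
  filter_upwards [isOpen_Ioi.mem_nhds ht] with s hs using hX s (le_of_lt hs)

theorem proposition4p1 (μ : Measure ℝ) [IsProbabilityMeasure μ]
    (hμ : Integrable (fun x : ℝ => x ^ 2) μ)
    (Xbar : Lp ℝ 2 μ) (hXbar : Xbar ∈ StickyParticles.monotoneCone μ)
    (Y : ℝ → Lp ℝ 2 μ) (hY : ContinuousOn Y (Set.Ici 0))
    (X : ℝ → Lp ℝ 2 μ)
    (hX : ∀ t : ℝ, 0 ≤ t →
      X t = StickyParticles.projCone μ (Xbar + ∫ s in (0 : ℝ)..t, Y s)) :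
    ∀ᵐ t ∂(volume.restrict (Set.Ici (0 : ℝ))),
      HasDerivAt X ((StickyParticles.closedSpan μ (X t)).starProjection (Y t)) t :=
  proposition4p1_general μ Xbar Y hY X hX
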